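/- Let $k\ge 4$ and $n\ge 0$ be integers. Let $B_n$ be the Boolean lattice of all subsets of $\{1,\dots,n\}$, and let $\Delta(B_n)$ be the order complex of $B_n\setminus\{\hat 0,\hat 1\}$: its simplices are the nonempty chains of nonempty proper subsets of $\{1,\dots,n\}$. For a simplicial complex $\Delta$, an integer $q\ge 0$ and a maximal simplex $\sigma_0$ of $\Delta$ of dimension at least $q$, a $q$-loop based at $\sigma_0$ is a finite sequence of simplices of $\Delta$, beginning and ending at $\sigma_0$, in which any two consecutive simplices share a $q$-dimensional face. The discrete fundamental group $A_1^q(\Delta,\sigma_0)$ is the set of $q$-loops based at $\sigma_0$ modulo the equivalence relation generated by (i) repeating a simplex of the loop, and (ii) replacing a loop $(\sigma_0,\sigma_1,\dots,\sigma_m)$ by a $q$-loop $(\tau_0,\tau_1,\dots,\tau_m)$ of the same length, also based at $\sigma_0$, such that $\sigma_i$ and $\tau_i$ share a $q$-dimensional face for every $i$; the group operation is concatenation of loops. Let $$M_{n,k}=\mathbb R^n\setminus\{x\in\mathbb R^n : x_{i_1}=x_{i_2}=\dots=x_{i_k}\text{ for some }1\le i_1<\dots<i_k\le n\}$$ be the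 complement of the real $k$-equal arrangement. 1. If $k\le n$, then $A_1^{n-k}(\Delta(B_n),\sigma_0)$ is the trivial group for every maximal simplex $\sigma_0$ of $\Delta(B_n)$ of dimension at least $n-k$. 2. The first Betti number of $M_{n,k}$, that is, the rank of the singular cohomology group $H^1(M_{n,k};\mathbb Z)$, is $0$. -/

import Mathlib

/-! ## Discrete homotopy of simplicial complexes -/

namespace DiscreteHomotopy

section General

variable {ι : Type*}

/-- The simplices `σ` and `τ` of `Δ` share a `q`-face: some `q`-dimensional simplex of `Δ`
(that is, one with `q + 1` vertices) is a face of both. -/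
def SharesFace (Δ : AbstractSimplicialComplex ι) (q : ℕ) (σ τ : Δ) : Prop :=
  ∃ ρ : Δ, ρ.1.card = q + 1 ∧ ρ.1 ⊆ σ.1 ∧ ρ.1 ⊆ τ.1

/-- The maximal simplices of `Δ` of dimension at least `q`; these serve as base simplices. -/
structure BaseSimplex (Δ : AbstractSimplicialComplex ι) (q : ℕ) where
  simplex : Δ
  maximal : ∀ τ : Δ, simplex.1 ⊆ τ.1 → τ = simplex
  le_dim : q + 1 ≤ simplex.1.card

/-- A `q`-loop in `Δ` based at `σ₀`: a finite sequence of (not necessarily maximal, not necessarily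
distinct) simplices beginning and ending at `σ₀`, any two consecutive ones sharing a `q`-face. -/
@[ext]
structure QLoop (Δ : AbstractSimplicialComplex ι) (q : ℕ) (σ₀ : BaseSimplex Δ q) where
  simplices : List Δ
  head_eq : simplices.head? = some σ₀.simplex
  last_eq : simplices.getLast? = some σ₀.simplex
  chain : simplices.IsChain (SharesFace Δ q)

variable {Δ : AbstractSimplicialComplex ι} {q : ℕ} {σ₀ : BaseSimplex Δ q}

/-- `γ'` arises from `γ` by repeating one of its simplices. -/
def Stretch (γ γ' : QLoop Δ q σ₀) : Prop :=
  ∃ (l₁ l₂ : List Δ) (σ : Δ),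
    γ.simplices = l₁ ++ σ :: l₂ ∧ γ'.simplices = l₁ ++ σ :: σ :: l₂

/-- `γ` and `γ'` can be two consecutive rows of a homotopy grid: they have the same length, and
simplices in the same column share a `q`-face. -/
def GridStep (γ γ' : QLoop Δ q σ₀) : Prop :=
  List.Forall₂ (SharesFace Δ q) γ.simplices γ'.simplices

/-- `γ` and `γ'` are the first and the last row of a grid all of whose rows are `q`-loops based
at `σ₀` and whose vertically adjacent simplices share a `q`-face. -/
def Grid (γ γ' : QLoop Δ q σ₀) : Prop :=
  Relation.ReflTransGen GridStep γ γ'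

variable (Δ q σ₀) in
/-- `A`-homotopy: the equivalence relation on `q`-loops based at `σ₀` generated by stretching and
by grids. -/
def aHomotopy : Setoid (QLoop Δ q σ₀) :=
  Relation.EqvGen.setoid fun γ γ' => Stretch γ γ' ∨ Grid γ γ'

variable (Δ q σ₀) in
/-- The underlying set of the discrete fundamental group `A₁^q(Δ, σ₀)`. -/
def A₁ : Type _ := Quotient (aHomotopy Δ q σ₀)

theorem SharesFace.symm {σ τ : Δ} (h : SharesFace Δ q σ τ) : SharesFace Δ q τ σ := by
  obtain ⟨ρ, h0, h1, h2⟩ := h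
  exact ⟨ρ, h0, h2, h1⟩

theorem SharesFace.refl_left {σ τ : Δ} (h : SharesFace Δ q σ τ) : SharesFace Δ q σ σ := by
  obtain ⟨ρ, h0, h1, -⟩ := h
  exact ⟨ρ, h0, h1, h1⟩

theorem BaseSimplex.sharesFace_self (σ₀ : BaseSimplex Δ q) :
    SharesFace Δ q σ₀.simplex σ₀.simplex := by
  obtain ⟨t, ht, hc⟩ := Finset.exists_subset_card_eq σ₀.le_dim
  have hne : t.Nonempty := Finset.card_pos.1 (by omega)
  exact ⟨⟨t, (Δ.isRelLowerSet_faces σ₀.simplex.2).2 ht hne⟩, hc, ht, ht⟩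

namespace QLoop

theorem ne_nil (γ : QLoop Δ q σ₀) : γ.simplices ≠ [] := by
  intro h
  have := γ.head_eq
  simp [h] at this

theorem refl_of_mem (γ : QLoop Δ q σ₀) {σ : Δ} (hσ : σ ∈ γ.simplices) : SharesFace Δ q σ σ := by
  obtain ⟨l₁, l₂, h⟩ := List.append_of_mem hσ
  have hc := γ.chain
  rw [h] at hc
  cases l₂ with
  | nil =>
    have hl := γ.last_eq
    rw [h] at hl
    simp at hl
    rw [hl]
    exact σ₀.sharesFace_self
  | cons τ l₂ => exact (List.isChain_append_cons_cons.1 hc).2.1.refl_left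

/-- The constant loop `(σ₀)`. -/
def const (Δ : AbstractSimplicialComplex ι) (q : ℕ) (σ₀ : BaseSimplex Δ q) : QLoop Δ q σ₀ where
  simplices := [σ₀.simplex]
  head_eq := rfl
  last_eq := rfl
  chain := List.isChain_singleton _

/-- Concatenation of loops. (Writing the base simplex at the junction once or twice gives loops
that differ by a stretch.) -/
def concat (γ γ' : QLoop Δ q σ₀) : QLoop Δ q σ₀ where
  simplices := γ.simplices ++ γ'.simplices
  head_eq := by simp [List.head?_append, γ.head_eq]
  last_eq := by simp [List.getLast?_append, γ'.last_eq]
  chain := by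
    refine List.isChain_append.2 ⟨γ.chain, γ'.chain, ?_⟩
    intro x hx y hy
    rw [γ.last_eq] at hx
    rw [γ'.head_eq] at hy
    cases hx
    cases hy
    exact σ₀.sharesFace_self

/-- The loop traversed backwards. -/
def reverse (γ : QLoop Δ q σ₀) : QLoop Δ q σ₀ where
  simplices := γ.simplices.reverse
  head_eq := by simp [γ.last_eq]
  last_eq := by simp [γ.head_eq]
  chain := List.isChain_reverse.2 (γ.chain.imp fun _ _ h => h.symm)

end QLoop

theorem aHomotopy_of_stretch {γ γ' : QLoop Δ q σ₀} (h : Stretch γ γ') :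
    (aHomotopy Δ q σ₀) γ γ' := Relation.EqvGen.rel _ _ (Or.inl h)

theorem aHomotopy_of_gridStep {γ γ' : QLoop Δ q σ₀} (h : GridStep γ γ') :
    (aHomotopy Δ q σ₀) γ γ' := Relation.EqvGen.rel _ _ (Or.inr (Relation.ReflTransGen.single h))

/-- A map of loops that respects stretches and grid steps respects `A`-homotopy. -/
theorem aHomotopy_map (f : QLoop Δ q σ₀ → QLoop Δ q σ₀)
    (hs : ∀ γ γ', Stretch γ γ' → Stretch (f γ) (f γ'))
    (hg : ∀ γ γ', GridStep γ γ' → GridStep (f γ) (f γ'))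
    {γ γ' : QLoop Δ q σ₀} (h : (aHomotopy Δ q σ₀) γ γ') :
    (aHomotopy Δ q σ₀) (f γ) (f γ') := by
  induction h with
  | rel x y h =>
    rcases h with h | h
    · exact aHomotopy_of_stretch (hs _ _ h)
    · exact Relation.EqvGen.rel _ _ (Or.inr (Relation.ReflTransGen.lift f (fun a b hab => hg a b hab) x y h))
  | refl x => exact (aHomotopy Δ q σ₀).refl _
  | symm x y _ ih => exact (aHomotopy Δ q σ₀).symm ih
  | trans x y z _ _ ih1 ih2 => exact (aHomotopy Δ q σ₀).trans ih1 ih2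

theorem forall₂_self (γ : QLoop Δ q σ₀) :
    List.Forall₂ (SharesFace Δ q) γ.simplices γ.simplices :=
  List.forall₂_same.2 fun _ h => γ.refl_of_mem h

theorem concat_congr {γ₁ γ₁' γ₂ γ₂' : QLoop Δ q σ₀} (h₁ : (aHomotopy Δ q σ₀) γ₁ γ₁')
    (h₂ : (aHomotopy Δ q σ₀) γ₂ γ₂') :
    (aHomotopy Δ q σ₀) (γ₁.concat γ₂) (γ₁'.concat γ₂') := by
  refine (aHomotopy Δ q σ₀).trans (b := γ₁'.concat γ₂) ?_ ?_
  · refine aHomotopy_map (fun γ => γ.concat γ₂) ?_ ?_ h₁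
    · rintro γ γ' ⟨l₁, l₂, σ, h, h'⟩
      exact ⟨l₁, l₂ ++ γ₂.simplices, σ, by simp [QLoop.concat, h], by simp [QLoop.concat, h']⟩
    · intro γ γ' h
      exact List.rel_append h (forall₂_self γ₂)
  · refine aHomotopy_map (fun γ => γ₁'.concat γ) ?_ ?_ h₂
    · rintro γ γ' ⟨l₁, l₂, σ, h, h'⟩
      exact ⟨γ₁'.simplices ++ l₁, l₂, σ, by simp [QLoop.concat, h], by simp [QLoop.concat, h']⟩
    · intro γ γ' h
      exact List.rel_append (forall₂_self γ₁') h

theorem reverse_congr {γ γ' : QLoop Δ q σ₀} (h : (aHomotopy Δ q σ₀) γ γ') :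
    (aHomotopy Δ q σ₀) γ.reverse γ'.reverse := by
  refine aHomotopy_map QLoop.reverse ?_ ?_ h
  · rintro γ γ' ⟨l₁, l₂, σ, h, h'⟩
    exact ⟨l₂.reverse, l₁.reverse, σ, by simp [QLoop.reverse, h], by simp [QLoop.reverse, h']⟩
  · intro γ γ' h
    exact List.rel_reverse h

theorem const_concat (γ : QLoop Δ q σ₀) :
    (aHomotopy Δ q σ₀) ((QLoop.const Δ q σ₀).concat γ) γ := by
  refine (aHomotopy Δ q σ₀).symm (aHomotopy_of_stretch ?_)
  obtain ⟨l, hl⟩ := List.head?_eq_some_iff.1 γ.head_eq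
  exact ⟨[], l, σ₀.simplex, by simp [hl], by simp [QLoop.concat, QLoop.const, hl]⟩

theorem concat_const (γ : QLoop Δ q σ₀) :
    (aHomotopy Δ q σ₀) (γ.concat (QLoop.const Δ q σ₀)) γ := by
  refine (aHomotopy Δ q σ₀).symm (aHomotopy_of_stretch ?_)
  obtain ⟨l, hl⟩ := List.getLast?_eq_some_iff.1 γ.last_eq
  exact ⟨l, [], σ₀.simplex, by simp [hl], by simp [QLoop.concat, QLoop.const, hl]⟩

/-- A loop that goes along `l` and back the same way is null-homotopic. -/
theorem palindrome_const (l : List Δ) (γ : QLoop Δ q σ₀) (h : γ.simplices = l ++ l.reverse) :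
    (aHomotopy Δ q σ₀) γ (QLoop.const Δ q σ₀) := by
  induction l using List.reverseRecOn generalizing γ with
  | nil => exact absurd h γ.ne_nil
  | append_singleton l y ih =>
    rcases List.eq_nil_or_concat l with rfl | ⟨p, x, rfl⟩
    · refine (aHomotopy Δ q σ₀).symm (aHomotopy_of_stretch ⟨[], [], σ₀.simplex, rfl, ?_⟩)
      have hy := γ.head_eq
      rw [h] at hy
      simp at hy
      simp [h, hy]
    · have h0 : γ.simplices = p ++ x :: y :: y :: x :: p.reverse := by simp [h]
      have hc := γ.chain
      rw [h0] at hc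
      obtain ⟨hc1, hxy, hc2⟩ := List.isChain_append_cons_cons.1 hc
      have hc3 : (x :: p.reverse).IsChain (SharesFace Δ q) := hc2.tail.tail
      have hxx := hxy.refl_left
      have hhd : (p ++ [x]).head? = some σ₀.simplex := by
        have := γ.head_eq
        rw [h0] at this
        cases p <;> simpa using this
      have hlst : (x :: p.reverse).getLast? = some σ₀.simplex := by
        have := γ.last_eq
        rw [h0] at this
        simpa [List.getLast?_append] using this
      have head_aux : ∀ m : List Δ, (p ++ x :: m).head? = some σ₀.simplex := by
        intro m
        cases p <;> simpa using hhd
      have last_aux : ∀ m : List Δ,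
          (m ++ x :: p.reverse).getLast? = some σ₀.simplex := by
        intro m
        rw [List.getLast?_append, hlst]
        rfl
      let γ2 : QLoop Δ q σ₀ :=
        { simplices := p ++ x :: x :: p.reverse
          head_eq := head_aux _
          last_eq := by simpa using last_aux (p ++ [x])
          chain := List.isChain_append_cons_cons.2 ⟨hc1, hxx, hc3⟩ }
      let γ3 : QLoop Δ q σ₀ :=
        { simplices := p ++ x :: x :: x :: p.reverse
          head_eq := head_aux _
          last_eq := by simpa using last_aux (p ++ [x, x])
          chain := List.isChain_append_cons_cons.2 ⟨hc1, hxx, .cons_cons hxx hc3⟩ }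
      let γ4 : QLoop Δ q σ₀ :=
        { simplices := p ++ x :: x :: x :: x :: p.reverse
          head_eq := head_aux _
          last_eq := by simpa using last_aux (p ++ [x, x, x])
          chain := List.isChain_append_cons_cons.2
            ⟨hc1, hxx, .cons_cons hxx (.cons_cons hxx hc3)⟩ }
      have s1 : (aHomotopy Δ q σ₀) γ γ4 := by
        refine aHomotopy_of_gridStep ?_
        have hp : List.Forall₂ (SharesFace Δ q) p p := List.forall₂_same.2 fun s hs =>
          γ.refl_of_mem (by rw [h0]; simp [hs])
        have hp' : List.Forall₂ (SharesFace Δ q) p.reverse p.reverse := List.rel_reverse hp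
        show List.Forall₂ _ γ.simplices (p ++ x :: x :: x :: x :: p.reverse)
        rw [h0]
        exact List.rel_append hp
          (.cons hxx (.cons hxy.symm (.cons hxy.symm (.cons hxx hp'))))
      have s2 : (aHomotopy Δ q σ₀) γ3 γ4 :=
        aHomotopy_of_stretch ⟨p, x :: x :: p.reverse, x, rfl, rfl⟩
      have s3 : (aHomotopy Δ q σ₀) γ2 γ3 :=
        aHomotopy_of_stretch ⟨p, x :: p.reverse, x, rfl, rfl⟩
      have s4 : (aHomotopy Δ q σ₀) γ2 (QLoop.const Δ q σ₀) := ih γ2 (by simp [γ2])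
      exact (aHomotopy Δ q σ₀).trans s1 ((aHomotopy Δ q σ₀).trans
        ((aHomotopy Δ q σ₀).symm ((aHomotopy Δ q σ₀).trans s3 s2)) s4)

/-- The group structure on `A₁^q(Δ, σ₀)` induced by concatenation of loops. -/
instance : Group (A₁ Δ q σ₀) where
  mul := Quotient.map₂ QLoop.concat fun _ _ h₁ _ _ h₂ => concat_congr h₁ h₂
  one := Quotient.mk _ (QLoop.const Δ q σ₀)
  inv := Quotient.map QLoop.reverse fun _ _ h => reverse_congr h
  mul_assoc := by
    rintro ⟨a⟩ ⟨b⟩ ⟨c⟩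
    exact congrArg (Quotient.mk _) (QLoop.ext (List.append_assoc _ _ _))
  one_mul := by
    rintro ⟨a⟩
    exact Quotient.sound (const_concat a)
  mul_one := by
    rintro ⟨a⟩
    exact Quotient.sound (concat_const a)
  inv_mul_cancel := by
    rintro ⟨a⟩
    exact Quotient.sound
      (palindrome_const a.simplices.reverse _ (by simp [QLoop.concat, QLoop.reverse]))

end General

/-! ## The order complex of the Boolean lattice -/

/-- The order complex of a poset: its simplices are the nonempty finite chains. -/
def orderComplex (P : Type*) [PartialOrder P] : AbstractSimplicialComplex P where
  faces := {s | s.Nonempty ∧ IsChain (· ≤ ·) (s : Set P)}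
  isRelLowerSet_faces := fun _ hs => ⟨hs.1, fun _ hts ht => ⟨ht, hs.2.mono hts⟩⟩
  singleton_mem := fun v => ⟨Finset.singleton_nonempty v, by simp⟩

/-- The proper part `B_n - {0̂, 1̂}` of the Boolean lattice `B_n` of subsets of an `n`-element set:
the nonempty proper subsets, ordered by inclusion. -/
abbrev BooleanProperPart (n : ℕ) : Type :=
  {s : Finset (Fin n) // s ≠ ⊥ ∧ s ≠ ⊤}

/-- The complex `Δ(B_n)`. -/
abbrev booleanOrderComplex (n : ℕ) : AbstractSimplicialComplex (BooleanProperPart n) :=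
  orderComplex (BooleanProperPart n)

/-! ## The `k`-equal arrangement and the first Betti number -/

/-- The union `V_{n,k}` of the real `k`-equal arrangement: the points of `ℝⁿ` with some `k`
coordinates (at distinct positions) all equal. -/
def kEqualArrangement (n k : ℕ) : Set (Fin n → ℝ) :=
  {x | ∃ s : Finset (Fin n), s.card = k ∧ ∀ i ∈ s, ∀ j ∈ s, x i = x j}

/-- The complement `M_{n,k}` of the `k`-equal arrangement, with the subspace topology. -/
abbrev kEqualComplement (n k : ℕ) : TopCat.{0} :=
  TopCat.of ((kEqualArrangement n k)ᶜ : Set (Fin n → ℝ))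

/-- Integral singular cohomology `H^i(X; ℤ)`: the cohomology of the cochain complex
`Hom(C_•(X), ℤ)`, where `C_•(X)` is the integral singular chain complex of `X`. -/
noncomputable def singularCohomology (X : TopCat.{0}) (i : ℕ) : ModuleCat.{0} ℤ :=
  ((((AlgebraicTopology.singularChainComplexFunctor (ModuleCat.{0} ℤ)).obj
    (ModuleCat.of ℤ ℤ)).obj X).linearYonedaObj ℤ (ModuleCat.of ℤ ℤ)).homology i

/-- The first Betti number of `X`: the rank of `H^1(X; ℤ)`. It is a cardinal number, so that the
value `0` does not also stand for an infinite rank. -/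
noncomputable def firstBettiNumber (X : TopCat.{0}) : Cardinal.{0} :=
  Module.rank ℤ (singularCohomology X 1)

end DiscreteHomotopy

/-! Both halves say that codimension at least three forces triviality. For the discrete group,
facets of `Δ(B_n)` correspond to permutations. Relative to a base permutation `w₀`, call undoing an
adjacent inversion a descent. Two descents from the same `w` together destroy at most two of the `n
- 1` vertices of its facet, so the three facets share at least `n - 3 ≥ q + 1` vertices, where `q =
n - k`. They thus lie in the star of one chain, whose facets pairwise share a `q`-face. As each star
has a unique member without descents inside it (`eq_of_no_descent`), Newman's confluence argument
(`exists_potential`) yields paths from `w₀` that contract every loop. For the Betti number, the span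
of a `k`-equal subspace (codimension `k - 1 ≥ 3`) and two further points is a proper subspace. A
generic apex therefore cones off any finite set of segments inside the complement, which makes a
1-cocycle a coboundary on segments (`exists_primitive_on_segments`) and, by local straightening, on
all paths (`exists_primitive`). -/

namespace DiscreteHomotopy

/-! ### Path homotopy and contraction by confluent descents -/

section PathHomotopy

variable {α : Type*} {R : α → α → Prop}

/-- Homotopy of sequences relative to a relation `R`: the equivalence relation generated by
repeating a term and by replacing an edge of a triangle by the other two edges. -/
inductive PathHomotopy (R : α → α → Prop) : List α → List α → Prop
  | refl (l : List α) : PathHomotopy R l l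
  | symm {l l' : List α} : PathHomotopy R l l' → PathHomotopy R l' l
  | trans {l l' l'' : List α} :
      PathHomotopy R l l' → PathHomotopy R l' l'' → PathHomotopy R l l''
  | stretch (l₁ l₂ : List α) {a : α} : R a a → PathHomotopy R (l₁ ++ a :: l₂) (l₁ ++ a :: a :: l₂)
  | triangle (l₁ l₂ : List α) {a b c : α} : R a b → R b c → R a c →
      PathHomotopy R (l₁ ++ a :: c :: l₂) (l₁ ++ a :: b :: c :: l₂)

theorem PathHomotopy.append_right {l l' : List α} (h : PathHomotopy R l l') (m : List α) :
    PathHomotopy R (l ++ m) (l' ++ m) := by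
  induction h with
  | refl l => exact .refl _
  | symm _ ih => exact .symm ih
  | trans _ _ ih1 ih2 => exact .trans ih1 ih2
  | stretch l₁ l₂ h => simpa using PathHomotopy.stretch l₁ (l₂ ++ m) h
  | triangle l₁ l₂ h1 h2 h3 => simpa using PathHomotopy.triangle l₁ (l₂ ++ m) h1 h2 h3

/-- The conditions on a sequence to be a closed `R`-path based at `a`. -/
def IsClosedPath (R : α → α → Prop) (a : α) (l : List α) : Prop :=
  l.head? = some a ∧ l.getLast? = some a ∧ l.IsChain R

/-- Ensures that the intermediate lists of a homotopy starting at a loop are again loops; the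
triangle move carries all three edges for this purpose. -/
theorem PathHomotopy.isClosedPath_iff {l l' : List α} (h : PathHomotopy R l l') (a : α) :
    IsClosedPath R a l ↔ IsClosedPath R a l' := by
  induction h with
  | refl l => exact Iff.rfl
  | symm _ ih => exact ih.symm
  | trans _ _ ih1 ih2 => exact ih1.trans ih2
  | stretch l₁ l₂ h =>
    unfold IsClosedPath
    refine and_congr (by simp [List.head?_append]) (and_congr (by
      simp [List.getLast?_append, List.getLast?_cons]) ?_)
    rw [List.isChain_append_cons_cons, List.isChain_split]
    tauto
  | triangle l₁ l₂ h1 h2 h3 =>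
    unfold IsClosedPath
    refine and_congr (by simp [List.head?_append]) (and_congr (by
      simp [List.getLast?_append, List.getLast?_cons]) ?_)
    rw [List.isChain_append_cons_cons, List.isChain_append_cons_cons, List.isChain_cons_cons]
    tauto

variable {ι : Type*} {Δ : AbstractSimplicialComplex ι} {q : ℕ} {σ₀ : BaseSimplex Δ q}

theorem QLoop.isClosedPath (γ : QLoop Δ q σ₀) :
    IsClosedPath (SharesFace Δ q) σ₀.simplex γ.simplices :=
  ⟨γ.head_eq, γ.last_eq, γ.chain⟩

/-- A triangle move is a stretch followed by a grid step: `a, c` becomes `a, a, c`, which has the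
length of `a, b, c` and shares `q`-faces with it column by column. -/
theorem aHomotopy_of_pathHomotopy {l l' : List Δ} (h : PathHomotopy (SharesFace Δ q) l l')
    {γ γ' : QLoop Δ q σ₀} (hγ : γ.simplices = l) (hγ' : γ'.simplices = l') :
    (aHomotopy Δ q σ₀) γ γ' := by
  induction h generalizing γ γ' with
  | refl l =>
    obtain rfl : γ = γ' := QLoop.ext (hγ.trans hγ'.symm)
    exact (aHomotopy Δ q σ₀).refl _
  | symm _ ih => exact (aHomotopy Δ q σ₀).symm (ih hγ' hγ)
  | trans h1 _ ih1 ih2 =>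
    obtain ⟨h3, h4, h5⟩ := (h1.isClosedPath_iff _).1 (hγ ▸ γ.isClosedPath)
    exact (aHomotopy Δ q σ₀).trans (ih1 (γ' := ⟨_, h3, h4, h5⟩) hγ rfl) (ih2 rfl hγ')
  | stretch l₁ l₂ h => exact aHomotopy_of_stretch ⟨l₁, l₂, _, hγ, hγ'⟩
  | @triangle l₁ l₂ a b c h1 h2 h3 =>
    have hs := PathHomotopy.stretch (R := SharesFace Δ q) l₁ (c :: l₂) h1.refl_left
    obtain ⟨h4, h5, h6⟩ := (hs.isClosedPath_iff _).1 (hγ ▸ γ.isClosedPath)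
    refine (aHomotopy Δ q σ₀).trans (b := ⟨_, h4, h5, h6⟩)
      (aHomotopy_of_stretch ⟨l₁, c :: l₂, _, hγ, rfl⟩) (aHomotopy_of_gridStep ?_)
    have hself := forall₂_self γ'
    rw [hγ'] at hself
    show List.Forall₂ _ (l₁ ++ a :: a :: c :: l₂) γ'.simplices
    rw [hγ']
    rw [List.forall₂_same] at hself
    refine List.rel_append (List.forall₂_same.2 fun x hx => hself x (by simp [hx]))
      (.cons h1.refl_left (.cons h1 (.cons (hself c (by simp)) (List.forall₂_same.2 fun x hx =>
        hself x (by simp [hx])))))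

/-- A locally confluent system of descents, with confluence witnessed by cells consisting of
pairwise related elements, has a potential: a choice of paths from the least element `e` that is
compatible, up to homotopy, with moving inside a cell. -/
theorem exists_potential {W : Type*} (F : W → α) (D : W → W → Prop) (hD : WellFounded D)
    (cells : Set (Set W)) (e : W)
    (hcell : ∀ S ∈ cells, ∀ w ∈ S, ∀ w' ∈ S, R (F w) (F w'))
    (hmin : ∀ S ∈ cells, S.Nonempty → ∃ x ∈ S, ∀ w ∈ S, w ≠ x → ∃ u ∈ S, D u w)
    (hconf : ∀ u v w, D u w → D v w → ∃ S ∈ cells, u ∈ S ∧ v ∈ S ∧ w ∈ S)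
    (he : ∀ u, ¬ D u e) :
    ∃ Q : W → List α, Q e = [F e] ∧
      ∀ S ∈ cells, ∀ w ∈ S, ∀ w' ∈ S, PathHomotopy R (Q w ++ [F w']) (Q w') := by
  classical
  -- `Q w` lists the `F`-values along one chosen chain of descents from `w`, read upwards, so that
  -- it ends in `F w`.
  let step (w : W) (ih : ∀ u, D u w → List α) : List α :=
    if h : ∃ u, D u w then ih h.choose h.choose_spec ++ [F w] else [F w]
  let Q : W → List α := hD.fix step
  have hQ : ∀ w, Q w = if h : ∃ u, D u w then Q h.choose ++ [F w] else [F w] :=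
    fun w => hD.fix_eq step w
  have hlast : ∀ w, ∃ l, Q w = l ++ [F w] := by
    intro w
    rw [hQ]
    split_ifs
    · exact ⟨_, rfl⟩
    · exact ⟨[], rfl⟩
  -- descents are compatible with `Q` below `w`, hence so are moves towards the least element
  have key : ∀ S ∈ cells, ∀ x ∈ S, (∀ w ∈ S, w ≠ x → ∃ u ∈ S, D u w) → ∀ w ∈ S,
      (∀ v, (v = w ∨ Relation.TransGen D v w) → ∀ u, D u v → PathHomotopy R (Q v) (Q u ++ [F v])) →
      PathHomotopy R (Q w) (Q x ++ [F w]) := by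
    -- The compatibility hypothesis covers only `w` and what lies below it, so that `key` can be
    -- used inside the induction proving `hA`.
    intro S hS x hx hdesc w
    induction w using hD.induction with
    | _ w ih =>
      intro hw hA
      by_cases hwx : w = x
      · subst hwx
        obtain ⟨l, hl⟩ := hlast w
        rw [hl]
        simpa using PathHomotopy.stretch l [] (hcell S hS w hw w hw)
      · obtain ⟨u, hu, huw⟩ := hdesc w hw hwx
        have h1 := ih u huw hu fun v hv => hA v (Or.inr (by
          rcases hv with rfl | hv
          · exact .single huw
          · exact hv.tail huw))
        -- The path now ends in `F x, F u, F w`, a triangle of the cell, so `F u` can be dropped.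
        refine (hA w (Or.inl rfl) u huw).trans ((h1.append_right [F w]).trans ?_)
        obtain ⟨l, hl⟩ := hlast x
        rw [hl]
        simpa using (PathHomotopy.triangle l [] (hcell S hS x hx u hu) (hcell S hS u hu w hw)
          (hcell S hS x hx w hw)).symm
  -- Newman's argument: the chosen descent `v` and the given `u` share a cell with `w`, and the
  -- paths through either reduce to `Q x ++ [F w]` for the least element `x` of that cell.
  have hA : ∀ w u, D u w → PathHomotopy R (Q w) (Q u ++ [F w]) := by
    intro w
    induction w using hD.transGen.induction with
    | _ w ih =>
      intro u hu
      have hex : ∃ u, D u w := ⟨u, hu⟩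
      rw [hQ w, dif_pos hex]
      have hv := hex.choose_spec
      generalize hex.choose = v at hv ⊢
      obtain ⟨S, hS, huS, hvS, hwS⟩ := hconf u v w hu hv
      obtain ⟨x, hx, hdesc⟩ := hmin S hS ⟨u, huS⟩
      have aux : ∀ y, D y w → y ∈ S → PathHomotopy R (Q y ++ [F w]) (Q x ++ [F w]) := by
        intro y hy hyS
        have h1 := key S hS x hx hdesc y hyS fun z hz => ih z (by
          rcases hz with rfl | hz
          · exact .single hy
          · exact hz.tail hy)
        refine (h1.append_right [F w]).trans ?_
        obtain ⟨l, hl⟩ := hlast x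
        rw [hl]
        simpa using (PathHomotopy.triangle l [] (hcell S hS x hx y hyS) (hcell S hS y hyS w hwS)
          (hcell S hS x hx w hwS)).symm
      exact (aux v hv hvS).trans (aux u hu huS).symm
  refine ⟨Q, ?_, ?_⟩
  · rw [hQ, dif_neg]
    rintro ⟨u, hu⟩
    exact he u hu
  · intro S hS w hw w' hw'
    obtain ⟨x, hx, hdesc⟩ := hmin S hS ⟨w, hw⟩
    refine ((key S hS x hx hdesc w hw fun v _ => hA v).append_right [F w']).trans
      (.trans ?_ (key S hS x hx hdesc w' hw' fun v _ => hA v).symm)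
    obtain ⟨l, hl⟩ := hlast x
    rw [hl]
    simpa using (PathHomotopy.triangle l [] (hcell S hS x hx w hw) (hcell S hS w hw w' hw')
          (hcell S hS x hx w' hw')).symm

/-- A potential contracts every path along cells. -/
theorem pathHomotopy_of_potential {W : Type*} {F : W → α} {C : W → W → Prop} {Q : W → List α}
    (hQ : ∀ w w', C w w' → PathHomotopy R (Q w ++ [F w']) (Q w')) (l : List W) (a : W)
    (hl : (a :: l).IsChain C) :
    PathHomotopy R (Q a ++ l.map F) (Q ((a :: l).getLast (by simp))) := by
  induction l generalizing a with
  | nil => simpa using PathHomotopy.refl _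
  | cons b l ih =>
    rw [List.isChain_cons_cons] at hl
    have := (hQ a b hl.1).append_right (l.map F)
    simp only [List.append_assoc, List.singleton_append] at this
    simpa using this.trans (ih b hl.2)

end PathHomotopy

/-! ### Facets of the Boolean order complex as permutations -/

section BooleanLattice

variable {n : ℕ}

/-- The set `S` is an initial segment of the linear order `w 0, w 1, …`. -/
def IsInitialSegment (w : Equiv.Perm (Fin n)) (S : Finset (Fin n)) : Prop :=
  ∀ i j, w i ∈ S → w j ∉ S → i < j

/-- `u` arises from `w` by interchanging two adjacent terms that are out of order, for the order of
values given by `w₀`. -/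
def IsDescent (w₀ u w : Equiv.Perm (Fin n)) : Prop :=
  ∃ i j : Fin n, (i : ℕ) + 1 = j ∧ w₀.symm (w j) < w₀.symm (w i) ∧ u = w * Equiv.swap i j

/-- An adjacent swap loses only the initial segment cut off between the two positions. -/
theorem isInitialSegment_mul_swap {w : Equiv.Perm (Fin n)} {S : Finset (Fin n)}
    (h : IsInitialSegment w S) {i j : Fin n} (hij : (i : ℕ) + 1 = j)
    (hS : ¬ (w i ∈ S ∧ w j ∉ S)) : IsInitialSegment (w * Equiv.swap i j) S := by
  intro a b ha hb
  rw [Equiv.Perm.mul_apply] at ha hb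
  have h1 := h _ _ ha hb
  rw [Equiv.swap_apply_def] at ha h1
  rw [Equiv.swap_apply_def] at hb h1
  simp only [Fin.ext_iff, Fin.lt_def] at *
  split_ifs at * <;> first | omega | skip
  all_goals exact absurd ⟨ha, hb⟩ hS

/-- The first change is at position `i`, where the smaller value moves in. This order serves as the
termination measure and also selects the least element of a star. -/
theorem lex_lt_of_isDescent {w₀ u w : Equiv.Perm (Fin n)} (h : IsDescent w₀ u w) :
    toLex (fun i => w₀.symm (u i)) < toLex (fun i => w₀.symm (w i)) := by
  obtain ⟨i, j, hij, hlt, rfl⟩ := h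
  exact Pi.lex_desc (f := fun i => w₀.symm (w i)) (by rw [Fin.le_def]; omega) hlt

theorem wellFounded_lex (w₀ : Equiv.Perm (Fin n)) :
    WellFounded fun u w : Equiv.Perm (Fin n) =>
      toLex (fun i => w₀.symm (u i)) < toLex (fun i => w₀.symm (w i)) :=
  InvImage.wf (fun w : Equiv.Perm (Fin n) => toLex fun i => w₀.symm (w i))
    (wellFounded_lt (α := Lex (Fin n → Fin n)))

theorem exists_descent_between {f : Fin n → Fin n} {i j : Fin n} (hij : i < j) (h : f j < f i) :
    ∃ a b : Fin n, (a : ℕ) + 1 = b ∧ i ≤ a ∧ b ≤ j ∧ f b < f a := by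
  by_contra! hc
  have key : ∀ m (hm : m < n), (i : ℕ) ≤ m → m ≤ j → f i ≤ f ⟨m, hm⟩ := by
    intro m
    induction m with
    | zero =>
      intro hm h1 _
      have : i = ⟨0, hm⟩ := Fin.ext (by simpa using h1)
      rw [← this]
    | succ m ih =>
      intro hm h1 h2
      rcases h1.lt_or_eq with h1 | h1
      · exact (ih (by omega) (by omega) (by omega)).trans
          (hc ⟨m, by omega⟩ ⟨m + 1, hm⟩ rfl (by rw [Fin.le_def]; simp; omega)
            (by rw [Fin.le_def]; exact h2))
      · have : i = ⟨m + 1, hm⟩ := Fin.ext h1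
        rw [← this]
  exact absurd (key j j.2 hij.le le_rfl) (not_le.2 h)

/-- Two permutations refining the same chain, both without descents inside the star of the
chain, agree. -/
theorem eq_of_no_descent {P : Finset (Fin n) → Prop} {w₀ w x : Equiv.Perm (Fin n)}
    (hw : ∀ S, P S → IsInitialSegment w S) (hx : ∀ S, P S → IsInitialSegment x S)
    (hw' : ∀ u, IsDescent w₀ u w → ¬ ∀ S, P S → IsInitialSegment u S)
    (hx' : ∀ u, IsDescent w₀ u x → ¬ ∀ S, P S → IsInitialSegment u S) : w = x := by
  by_contra hne
  have hex : ∃ i, w i ≠ x i := by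
    by_contra! h
    exact hne (Equiv.ext h)
  obtain ⟨i, hi, hmin⟩ := WellFounded.has_min (wellFounded_lt (α := Fin n)) {i | w i ≠ x i} hex
  have hmin' : ∀ l, l < i → w l = x l := fun l hl => by
    by_contra h
    exact hmin l h hl
  clear hmin hex hne
  wlog hlt : w₀.symm (w i) < w₀.symm (x i) generalizing w x
  · refine this hx hw hx' hw' (fun h => hi h.symm) (fun l hl => (hmin' l hl).symm) ?_
    exact lt_of_le_of_ne (not_lt.1 hlt) fun h => hi (w₀.symm.injective h.symm)
  -- Let `j` be the place of `w i` in `x`; then `i < j` and `x` has an adjacent descent between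
  -- them. That descent must leave the star, so some `S` contains `x i` but not `w i`. Then `x i`
  -- precedes position `i` in `w`, where `w` and `x` agree, which is impossible.
  have hj : x (x.symm (w i)) = w i := x.apply_symm_apply _
  generalize x.symm (w i) = j at hj
  have hij : i < j := by
    rcases lt_trichotomy i j with h | h | h
    · exact h
    · exact absurd (h ▸ hj.symm) hi
    · rw [← hmin' j h] at hj
      exact absurd (w.injective hj) h.ne
  obtain ⟨a, b, hab, hia, hbj, hfab⟩ :=
    exists_descent_between (f := fun l => w₀.symm (x l)) hij (by simpa only [hj] using hlt)
  have := hx' _ ⟨a, b, hab, hfab, rfl⟩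
  push Not at this
  obtain ⟨S, hS, hSn⟩ := this
  have hcut : x a ∈ S ∧ x b ∉ S := by
    by_contra hcut
    exact hSn (isInitialSegment_mul_swap (hx S hS) hab hcut)
  have hxi : x i ∈ S := by
    by_contra h
    exact absurd (hx S hS _ _ hcut.1 h) (not_lt.2 hia)
  have hwi : w i ∉ S := by
    rw [← hj]
    intro h
    exact absurd (hx S hS _ _ h hcut.2) (not_lt.2 hbj)
  have hl := hw S hS (w.symm (x i)) i (by simpa using hxi) hwi
  have := hmin' _ hl
  rw [w.apply_symm_apply] at this
  exact absurd (x.injective this) hl.ne'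

/-- The facet of `Δ(B_n)` corresponding to a permutation. -/
noncomputable def permFace (w : Equiv.Perm (Fin n)) : Finset (BooleanProperPart n) :=
  by classical exact Finset.univ.filter fun S => IsInitialSegment w S.1

theorem mem_permFace {w : Equiv.Perm (Fin n)} {S : BooleanProperPart n} :
    S ∈ permFace w ↔ IsInitialSegment w S.1 := by
  simp [permFace]

theorem isChain_permFace (w : Equiv.Perm (Fin n)) :
    IsChain (· ≤ ·) (permFace w : Set (BooleanProperPart n)) := by
  intro S hS T hT _
  rw [Finset.mem_coe, mem_permFace] at hS hT
  by_contra! h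
  obtain ⟨a, haS, haT⟩ := Finset.not_subset.1 h.1
  obtain ⟨b, hbT, hbS⟩ := Finset.not_subset.1 h.2
  have h1 := hS (w.symm a) (w.symm b) (by simpa) (by simpa)
  have h2 := hT (w.symm b) (w.symm a) (by simpa) (by simpa)
  exact lt_asymm h1 h2

/-- Every chain of subsets is refined by some permutation. -/
theorem exists_subset_permFace (ρ : Finset (BooleanProperPart n))
    (hρ : IsChain (· ≤ ·) (ρ : Set (BooleanProperPart n))) : ∃ w, ρ ⊆ permFace w := by
  classical
  -- Sorting by the number of members of the chain that miss a point puts the points of smaller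
  -- members first.
  let f : Fin n → ℕ := fun a => (ρ.filter fun S => a ∉ S.1).card
  refine ⟨Tuple.sort f, fun S hS => mem_permFace.2 fun i j hi hj => ?_⟩
  by_contra h
  have hle : f _ ≤ f _ := Tuple.monotone_sort f (not_lt.1 h)
  refine absurd hle (not_le.2 (Finset.card_lt_card ?_))
  rw [Finset.ssubset_iff_of_subset]
  · exact ⟨S, by simp [hS, hj], by simp [hi]⟩
  · intro T hT
    rw [Finset.mem_filter] at hT ⊢
    refine ⟨hT.1, fun hjT => ?_⟩
    rcases hρ.total hS hT.1 with h' | h'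
    · exact hT.2 (h' hi)
    · exact hj (h' hjT)

/-- The set of the first `m` terms of `w`. -/
def initialSegment (w : Equiv.Perm (Fin n)) (m : ℕ) : Finset (Fin n) :=
  Finset.univ.filter fun a => (w.symm a : ℕ) < m

theorem apply_mem_initialSegment {w : Equiv.Perm (Fin n)} {m : ℕ} {i : Fin n} :
    w i ∈ initialSegment w m ↔ (i : ℕ) < m := by
  simp [initialSegment]

theorem initialSegment_proper (w : Equiv.Perm (Fin n)) {m : ℕ} (h0 : 0 < m) (hm : m < n) :
    initialSegment w m ≠ ⊥ ∧ initialSegment w m ≠ ⊤ := by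
  constructor
  · intro h
    have : w ⟨0, by omega⟩ ∈ initialSegment w m := apply_mem_initialSegment.2 h0
    simp [h] at this
  · intro h
    have : w ⟨m, hm⟩ ∉ initialSegment w m := fun h => by
      simpa using apply_mem_initialSegment.1 h
    simp [h] at this

/-- Two descents of the same permutation lie in the star of a chain of corank at most two. -/
theorem card_inter_permFace {w₀ u v w : Equiv.Perm (Fin n)} (hu : IsDescent w₀ u w)
    (hv : IsDescent w₀ v w) :
    ∃ ρ : Finset (BooleanProperPart n), n ≤ ρ.card + 3 ∧
      ρ ⊆ permFace u ∧ ρ ⊆ permFace v ∧ ρ ⊆ permFace w := by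
  classical
  obtain ⟨i, i', hi, -, rfl⟩ := hu
  obtain ⟨j, j', hj, -, rfl⟩ := hv
  -- Lengths of proper initial segments surviving both swaps: swapping positions `i` and `i' = i +
  -- 1` loses only the segment of length `i'`.
  let s : Finset ℕ := ((Finset.Ioo 0 n).erase i').erase j'
  have hs : ∀ m ∈ s, (0 < m ∧ m < n) ∧ m ≠ i' ∧ m ≠ j' := by
    intro m hm
    simp only [s, Finset.mem_erase, Finset.mem_Ioo] at hm
    tauto
  let g : s → BooleanProperPart n := fun m =>
    ⟨initialSegment w m, initialSegment_proper w (hs m m.2).1.1 (hs m m.2).1.2⟩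
  have hg : Function.Injective g := by
    intro a b hab
    have h : initialSegment w a = initialSegment w b := congrArg Subtype.val hab
    have ha := (hs a a.2).1.2
    have hb := (hs b b.2).1.2
    have h1 := apply_mem_initialSegment (w := w) (m := a) (i := ⟨b, hb⟩)
    have h2 := apply_mem_initialSegment (w := w) (m := a) (i := ⟨a, ha⟩)
    have h3 := apply_mem_initialSegment (w := w) (m := b) (i := ⟨b, hb⟩)
    have h4 := apply_mem_initialSegment (w := w) (m := b) (i := ⟨a, ha⟩)
    rw [h] at h1 h2
    rw [h1] at h3
    rw [h2] at h4
    refine Subtype.ext ?_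
    simp only at h3 h4
    omega
  have hinit : ∀ m, IsInitialSegment w (initialSegment w m) := by
    intro m a b ha hb
    rw [apply_mem_initialSegment] at ha hb
    rw [Fin.lt_def]
    omega
  refine ⟨Finset.univ.image g, ?_, ?_, ?_, ?_⟩
  · rw [Finset.card_image_of_injective _ hg, Finset.card_univ, Fintype.card_coe]
    have h1 := Finset.pred_card_le_card_erase (s := (Finset.Ioo 0 n).erase (i' : ℕ)) (a := (j' : ℕ))
    have h2 := Finset.pred_card_le_card_erase (s := Finset.Ioo 0 n) (a := (i' : ℕ))
    rw [Nat.card_Ioo] at h2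
    change n ≤ (((Finset.Ioo 0 n).erase (i' : ℕ)).erase (j' : ℕ)).card + 3
    omega
  all_goals
    intro S hS
    obtain ⟨m, -, rfl⟩ := Finset.mem_image.1 hS
    have hm := hs m m.2
    rw [mem_permFace]
  · refine isInitialSegment_mul_swap (hinit m) hi ?_
    rw [apply_mem_initialSegment, apply_mem_initialSegment]
    omega
  · refine isInitialSegment_mul_swap (hinit m) hj ?_
    rw [apply_mem_initialSegment, apply_mem_initialSegment]
    omega
  · exact hinit m

theorem permFace_nonempty (hn : 2 ≤ n) (w : Equiv.Perm (Fin n)) : (permFace w).Nonempty := by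
  refine ⟨⟨initialSegment w 1, initialSegment_proper w one_pos hn⟩, mem_permFace.2 ?_⟩
  intro a b ha hb
  rw [apply_mem_initialSegment] at ha hb
  rw [Fin.lt_def]
  omega

/-- The facet of `Δ(B_n)` corresponding to a permutation, as a simplex. -/
noncomputable def permSimplex (hn : 2 ≤ n) (w : Equiv.Perm (Fin n)) : booleanOrderComplex n :=
  ⟨permFace w, permFace_nonempty hn w, isChain_permFace w⟩

theorem sharesFace_of_subset {q : ℕ} {σ τ ρ : booleanOrderComplex n} (hρ : q + 1 ≤ ρ.1.card)
    (hσ : ρ.1 ⊆ σ.1) (hτ : ρ.1 ⊆ τ.1) : SharesFace (booleanOrderComplex n) q σ τ := by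
  obtain ⟨t, ht, hc⟩ := Finset.exists_subset_card_eq hρ
  have hne : t.Nonempty := Finset.card_pos.1 (by omega)
  exact ⟨⟨t, ((booleanOrderComplex n).isRelLowerSet_faces ρ.2).2 ht hne⟩, hc,
    ht.trans hσ, ht.trans hτ⟩

/-- The stars of the chains with at least `q + 1` elements, as sets of permutations. -/
def permStars (n q : ℕ) : Set (Set (Equiv.Perm (Fin n))) :=
  {W | ∃ ρ : booleanOrderComplex n, q + 1 ≤ ρ.1.card ∧ W = {w | ρ.1 ⊆ permFace w}}

/-- The cells are stars. The bound `q + 4 ≤ n` is what turns the `n - 3` common vertices from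
`card_inter_permFace` into a `q`-face. -/
theorem exists_perm_potential {q : ℕ} (hn : 2 ≤ n) (hq : q + 4 ≤ n) (w₀ : Equiv.Perm (Fin n)) :
    ∃ Q : Equiv.Perm (Fin n) → List (booleanOrderComplex n), Q w₀ = [permSimplex hn w₀] ∧
      ∀ W ∈ permStars n q, ∀ w ∈ W, ∀ w' ∈ W,
        PathHomotopy (SharesFace (booleanOrderComplex n) q) (Q w ++ [permSimplex hn w']) (Q w') := by
  refine exists_potential (permSimplex hn) (IsDescent w₀)
    (Subrelation.wf lex_lt_of_isDescent (wellFounded_lex w₀)) (permStars n q) w₀ ?_ ?_ ?_ ?_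
  · rintro _ ⟨ρ, hρ, rfl⟩ w hw w' hw'
    exact sharesFace_of_subset hρ hw hw'
  · rintro _ ⟨ρ, hρ, rfl⟩ hne
    -- The lexicographic minimum has no descent in the star, so by uniqueness every other member has
    -- one.
    obtain ⟨x, hx, hmin⟩ := (wellFounded_lex w₀).has_min _ hne
    refine ⟨x, hx, fun w hw hwx => ?_⟩
    by_contra! hc
    have conv : ∀ u : Equiv.Perm (Fin n), u ∈ {w | ρ.1 ⊆ permFace w} ↔
        ∀ S, (∃ T ∈ ρ.1, T.1 = S) → IsInitialSegment u S := by
      intro u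
      constructor
      · rintro h _ ⟨T, hT, rfl⟩
        exact mem_permFace.1 (h hT)
      · exact fun h T hT => mem_permFace.2 (h _ ⟨T, hT, rfl⟩)
    refine hwx (eq_of_no_descent (w₀ := w₀) ((conv w).1 hw) ((conv x).1 hx) ?_ ?_)
    · intro u hu h
      exact hc u ((conv u).2 h) hu
    · intro u hu h
      exact hmin u ((conv u).2 h) (lex_lt_of_isDescent hu)
  · intro u v w hu hv
    obtain ⟨ρ, hρ, h1, h2, h3⟩ := card_inter_permFace hu hv
    refine ⟨_, ⟨⟨ρ, Finset.card_pos.1 (by omega), (isChain_permFace w).mono h3⟩, ?_, rfl⟩,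
      h1, h2, h3⟩
    show q + 1 ≤ ρ.card
    omega
  · rintro u ⟨i, j, hij, hlt, -⟩
    simp only [Equiv.symm_apply_apply, Fin.lt_def] at hlt
    omega

/-- One grid step enlarges every simplex to a facet, fixing the base simplex by maximality. A
`q`-face shared by neighbours puts their permutations in a common star, so the potential contracts
the enlarged loop. -/
theorem aHomotopy_const {q : ℕ} (hq : q + 4 ≤ n) {σ₀ : BaseSimplex (booleanOrderComplex n) q}
    (γ : QLoop (booleanOrderComplex n) q σ₀) :
    (aHomotopy (booleanOrderComplex n) q σ₀) γ (QLoop.const _ q σ₀) := by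
  have hn : 2 ≤ n := by omega
  choose w hw using fun σ : booleanOrderComplex n => exists_subset_permFace σ.1 σ.2.2
  have hbase : permSimplex hn (w σ₀.simplex) = σ₀.simplex := σ₀.maximal _ (hw _)
  have hstar : ∀ σ τ, SharesFace (booleanOrderComplex n) q σ τ →
      ∃ W ∈ permStars n q, w σ ∈ W ∧ w τ ∈ W := by
    rintro σ τ ⟨ρ, hc, h1, h2⟩
    exact ⟨_, ⟨ρ, hc.ge, rfl⟩, h1.trans (hw σ), h2.trans (hw τ)⟩
  have hshare : ∀ σ τ, SharesFace (booleanOrderComplex n) q σ τ →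
      SharesFace (booleanOrderComplex n) q (permSimplex hn (w σ)) (permSimplex hn (w τ)) := by
    intro σ τ h
    obtain ⟨ρ, hc, h1, h2⟩ := h
    exact sharesFace_of_subset hc.ge (h1.trans (hw σ)) (h2.trans (hw τ))
  let γ' : QLoop (booleanOrderComplex n) q σ₀ :=
    { simplices := γ.simplices.map fun σ => permSimplex hn (w σ)
      head_eq := by simp [γ.head_eq, hbase]
      last_eq := by simp [γ.last_eq, hbase]
      chain := (List.isChain_map _).2 (γ.chain.imp hshare) }
  have hstep : GridStep γ γ' := by
    refine List.forall₂_map_right_iff.2 (List.forall₂_same.2 fun σ hσ => ?_)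
    obtain ⟨ρ, hc, h1, -⟩ := γ.refl_of_mem hσ
    exact sharesFace_of_subset hc.ge h1 (h1.trans (hw σ))
  refine (aHomotopy _ q σ₀).trans (aHomotopy_of_gridStep hstep) ?_
  obtain ⟨Q, hQ0, hQ⟩ := exists_perm_potential hn hq (w σ₀.simplex)
  obtain ⟨l, hl⟩ := List.head?_eq_some_iff.1 γ.head_eq
  have hchain : (w σ₀.simplex :: l.map w).IsChain fun a b => ∃ W ∈ permStars n q, a ∈ W ∧ b ∈ W := by
    have := γ.chain.imp hstar
    rw [hl] at this
    exact (List.isChain_map w (l := σ₀.simplex :: l)).2 this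
  have hmain := pathHomotopy_of_potential (F := permSimplex hn) (Q := Q)
    (C := fun a b => ∃ W ∈ permStars n q, a ∈ W ∧ b ∈ W)
    (fun a b ⟨W, hW, ha, hb⟩ => hQ W hW a ha b hb) _ _ hchain
  have hend : (w σ₀.simplex :: l.map w).getLast (by simp) = w σ₀.simplex := by
    have h1 : (γ.simplices.map w).getLast? = some (w σ₀.simplex) := by simp [γ.last_eq]
    simp only [hl, List.map_cons] at h1
    exact List.getLast_of_mem_getLast? h1
  rw [hend, hQ0, hbase] at hmain
  refine aHomotopy_of_pathHomotopy hmain ?_ rfl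
  simp [γ', hl, hbase, Function.comp_def]

end BooleanLattice

/-! ### Singular cohomology in degree one, in terms of functions on simplices -/

open CategoryTheory Simplicial

/-- A singular simplex, as a simplex of the singular simplicial set. -/
noncomputable def toSingularSimplex {X : TopCat.{0}} {m : ℕ}
    (σ : C(stdSimplex ℝ (Fin (m + 1)), X)) : (TopCat.toSSet.obj X) _⦋m⦌ :=
  (TopCat.toSSetObjEquiv X (.op ⦋m⦌)).symm σ

theorem toSingularSimplex_surjective {X : TopCat.{0}} {m : ℕ} :
    Function.Surjective (toSingularSimplex (X := X) (m := m)) :=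
  (TopCat.toSSetObjEquiv X (.op ⦋m⦌)).symm.surjective

/-- The `i`-th face inclusion of topological simplices. -/
noncomputable def stdFace (m : ℕ) (i : Fin (m + 2)) :
    C(stdSimplex ℝ (Fin (m + 1)), stdSimplex ℝ (Fin (m + 2))) :=
  ⟨stdSimplex.map i.succAbove, stdSimplex.continuous_map _⟩

/-- The first singular cohomology group vanishes when every `1`-cocycle on singular simplices is
the coboundary of a function on points. -/
theorem subsingleton_singularCohomology_one (X : TopCat.{0})
    (h : ∀ f : C(stdSimplex ℝ (Fin 2), X) → ℤ,
      (∀ σ : C(stdSimplex ℝ (Fin 3), X),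
        f (σ.comp (stdFace 1 0)) - f (σ.comp (stdFace 1 1)) + f (σ.comp (stdFace 1 2)) = 0) →
      ∃ g : C(stdSimplex ℝ (Fin 1), X) → ℤ, ∀ γ,
        f γ = g (γ.comp (stdFace 0 0)) - g (γ.comp (stdFace 0 1))) :
    Subsingleton (singularCohomology X 1) := by
  let S : SSet.{0} := TopCat.toSSet.obj X
  let R : ModuleCat.{0} ℤ := ModuleCat.of ℤ ℤ
  let K : ChainComplex (ModuleCat.{0} ℤ) ℕ := S.chainComplex R
  change Subsingleton ((K.linearYonedaObj ℤ R).homology 1)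
  rw [← ModuleCat.isZero_iff_subsingleton, ← HomologicalComplex.exactAt_iff_isZero_homology,
    HomologicalComplex.exactAt_iff' _ 0 1 2 (by simp) (by simp),
    ShortComplex.moduleCat_exact_iff]
  intro (φ : K.X 1 ⟶ R) hφ
  replace hφ : K.d 2 1 ≫ φ = 0 := hφ
  have hφ' : ∀ x : S _⦋2⦌, ((S.ιChainComplex x : R ⟶ K.X 2) ≫ K.d 2 1) ≫ φ = 0 := by
    intro x
    rw [Category.assoc, hφ, Limits.comp_zero]
  obtain ⟨g, hg⟩ := h
    (fun γ => ((S.ιChainComplex (toSingularSimplex γ) : R ⟶ K.X 1) ≫ φ).hom (1 : ℤ)) (by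
      intro σ
      have h1 := hφ' (toSingularSimplex σ)
      rw [SSet.ιChainComplex_d, Fin.sum_univ_three] at h1
      have h2 := congrArg (fun ψ : R ⟶ R => ψ.hom (1 : ℤ)) h1
      simp [Preadditive.add_comp, Preadditive.neg_comp] at h2
      rw [sub_eq_add_neg]
      exact h2)
  -- Degree-zero chains form a coproduct of copies of `ℤ`, so the function `g` on points defines a
  -- cochain by the universal property.
  let c (x : S _⦋0⦌) : R ⟶ R := ModuleCat.ofHom (LinearMap.toSpanSingleton ℤ ℤ
      (g (TopCat.toSSetObjEquiv X (.op ⦋0⦌) x)))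
  let ψ : K.X 0 ⟶ R := (S.isColimitChainComplexXCofan R 0).desc (Limits.Cofan.mk R c)
  have hψ : ∀ x, (S.ιChainComplex x : R ⟶ K.X 0) ≫ ψ = c x := fun x =>
    (S.isColimitChainComplexXCofan R 0).fac (Limits.Cofan.mk R c) ⟨x⟩
  refine ⟨ψ, ?_⟩
  change K.d 1 0 ≫ ψ = φ
  refine SSet.chainComplex_hom_ext fun x => ?_
  obtain ⟨γ, rfl⟩ := toSingularSimplex_surjective x
  have hd : (S.ιChainComplex (toSingularSimplex γ) : R ⟶ K.X 1) ≫ K.d 1 0 =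
      S.ιChainComplex (toSingularSimplex (γ.comp (stdFace 0 0))) -
        S.ιChainComplex (toSingularSimplex (γ.comp (stdFace 0 1))) := by
    refine (SSet.ιChainComplex_d S _ _).trans ?_
    rw [Fin.sum_univ_two]
    simp [sub_eq_add_neg]
    rfl
  rw [← Category.assoc]
  refine (congrArg (· ≫ ψ) hd).trans ?_
  rw [Preadditive.sub_comp, hψ, hψ]
  refine ModuleCat.hom_ext (LinearMap.ext_ring ?_)
  refine Eq.trans ?_ (hg γ).symm
  simp [c, toSingularSimplex]

/-! ### Cocycles on segments and paths -/

section Cochain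

variable {E : Type*} [NormedAddCommGroup E] {U : Set E}

open Classical in
/-- The value of a singular `1`-cochain of `U` on a map to `E`, zero if it is not a singular simplex
of `U`. -/
noncomputable def evalCochain (f : C(stdSimplex ℝ (Fin 2), U) → ℤ)
    (γ : stdSimplex ℝ (Fin 2) → E) : ℤ :=
  if h : Continuous γ ∧ ∀ p, γ p ∈ U then f ⟨fun p => ⟨γ p, h.2 p⟩, h.1.subtype_mk h.2⟩ else 0

theorem evalCochain_of (f : C(stdSimplex ℝ (Fin 2), U) → ℤ) (γ : C(stdSimplex ℝ (Fin 2), U)) :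
    evalCochain f (fun p => (γ p : E)) = f γ := by
  rw [evalCochain, dif_pos ⟨by fun_prop, fun p => (γ p).2⟩]
  rfl

/-- The cocycle condition for singular `1`-cochains. -/
def IsSingularCocycle {X : Type*} [TopologicalSpace X] (f : C(stdSimplex ℝ (Fin 2), X) → ℤ) : Prop :=
  ∀ σ : C(stdSimplex ℝ (Fin 3), X),
    f (σ.comp (stdFace 1 0)) - f (σ.comp (stdFace 1 1)) + f (σ.comp (stdFace 1 2)) = 0

variable {D : Type*} [AddCommGroup D] [Module ℝ D]

/-- The value of a `1`-cochain of `U` on the image under `Φ` of the segment from `a` to `b`. -/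
noncomputable def segmentValue (f : C(stdSimplex ℝ (Fin 2), U) → ℤ) (Φ : D → E) (a b : D) : ℤ :=
  evalCochain f fun p => Φ (p 0 • a + p 1 • b)

/-- The two parameter spaces may differ, which allows an edge of a square to be compared with a
segment in `E`. -/
theorem segmentValue_congr (f : C(stdSimplex ℝ (Fin 2), U) → ℤ) {D' : Type*} [AddCommGroup D']
    [Module ℝ D'] {Φ : D → E} {Φ' : D' → E} {a b : D} {a' b' : D'}
    (h : ∀ s t : ℝ, 0 ≤ s → 0 ≤ t → s + t = 1 → Φ (s • a + t • b) = Φ' (s • a' + t • b')) :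
    segmentValue f Φ a b = segmentValue f Φ' a' b' := by
  unfold segmentValue
  congr 1
  funext p
  exact h _ _ (p.2.1 0) (p.2.1 1) ((Fin.sum_univ_two _).symm.trans p.2.2)

theorem sum_stdSimplex_map {m m' : ℕ} (s : Fin m → Fin m') (p : stdSimplex ℝ (Fin m))
    (v : Fin m' → D) : ∑ i, (stdSimplex.map s p) i • v i = ∑ j, p j • v (s j) := by
  classical
  simp only [stdSimplex.map_coe, FunOnFinite.linearMap_apply_apply, Finset.sum_smul]
  rw [← Finset.sum_fiberwise Finset.univ s]
  refine Finset.sum_congr rfl fun i _ => Finset.sum_congr rfl fun j hj => ?_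
  rw [(Finset.mem_filter.1 hj).2]

/-- Apply the cocycle condition to the image under `Φ` of the affine triangle `a, b, c`, which stays
in `S` by convexity. -/
theorem segmentValue_triangle [TopologicalSpace D] [ContinuousAdd D]
    [ContinuousSMul ℝ D] {f : C(stdSimplex ℝ (Fin 2), U) → ℤ} (hf : IsSingularCocycle f)
    {Φ : D → E} {S : Set D} (hS : Convex ℝ S) (hΦ : ContinuousOn Φ S) (hU : Set.MapsTo Φ S U)
    {a b c : D} (ha : a ∈ S) (hb : b ∈ S) (hc : c ∈ S) :
    segmentValue f Φ a b + segmentValue f Φ b c = segmentValue f Φ a c := by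
  let v : Fin 3 → D := ![a, b, c]
  have hv : ∀ i, v i ∈ S := by
    intro i
    fin_cases i <;> assumption
  have hmem : ∀ p : stdSimplex ℝ (Fin 3), ∑ i, p i • v i ∈ S := fun p =>
    hS.sum_mem (fun i _ => p.2.1 i) p.2.2 fun i _ => hv i
  have hcont : Continuous fun p : stdSimplex ℝ (Fin 3) => Φ (∑ i, p i • v i) := by
    refine hΦ.comp_continuous ?_ hmem
    refine continuous_finsetSum _ fun i _ => Continuous.smul ?_ continuous_const
    exact (continuous_apply i).comp continuous_subtype_val
  let σ : C(stdSimplex ℝ (Fin 3), U) :=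
    ⟨fun p => ⟨Φ (∑ i, p i • v i), hU (hmem p)⟩, hcont.subtype_mk _⟩
  have hface : ∀ i : Fin 3, f (σ.comp (stdFace 1 i)) =
      segmentValue f Φ (v (i.succAbove 0)) (v (i.succAbove 1)) := by
    intro i
    rw [← evalCochain_of f, segmentValue]
    congr 1
    funext p
    change Φ (∑ j, (stdSimplex.map i.succAbove p) j • v j) = _
    rw [sum_stdSimplex_map, Fin.sum_univ_two]
  have h := hf σ
  rw [hface, hface, hface] at h
  change segmentValue f Φ b c - segmentValue f Φ a c + segmentValue f Φ a b = 0 at h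
  omega

theorem segmentValue_self [TopologicalSpace D] [ContinuousAdd D]
    [ContinuousSMul ℝ D] {f : C(stdSimplex ℝ (Fin 2), U) → ℤ} (hf : IsSingularCocycle f)
    {Φ : D → E} {a : D} (hU : Φ a ∈ U) : segmentValue f Φ a a = 0 := by
  have := segmentValue_triangle hf (Φ := Φ) (convex_singleton a) (continuousOn_singleton Φ a)
    (by rintro _ rfl; exact hU) rfl rfl rfl
  omega

variable [NormedSpace ℝ E]

theorem segmentValue_const {f : C(stdSimplex ℝ (Fin 2), U) → ℤ} (hf : IsSingularCocycle f)
    {Φ : D → E} {a b : D} {x : E} (hx : x ∈ U)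
    (h : ∀ s t : ℝ, 0 ≤ s → 0 ≤ t → s + t = 1 → Φ (s • a + t • b) = x) :
    segmentValue f Φ a b = 0 := by
  rw [← segmentValue_self hf (Φ := id) (a := x) hx]
  refine segmentValue_congr f fun s t hs ht hst => ?_
  rw [h s t hs ht hst, ← add_smul, hst, one_smul, id]

theorem segmentValue_comm {f : C(stdSimplex ℝ (Fin 2), U) → ℤ} (hf : IsSingularCocycle f)
    {a b : E} (h : segment ℝ a b ⊆ U) :
    segmentValue f id a b = - segmentValue f id b a := by
  have h1 := segmentValue_triangle hf (Φ := id) (convex_segment a b) continuousOn_id h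
    (left_mem_segment ℝ a b) (right_mem_segment ℝ a b) (left_mem_segment ℝ a b)
  have h2 := segmentValue_self hf (Φ := id) (a := a) (h (left_mem_segment ℝ a b))
  omega

/-- On a path inside a convex subset of `U`, a cocycle takes the same value as on the straight
segment. -/
theorem segmentValue_eq_of_convex {f : C(stdSimplex ℝ (Fin 2), U) → ℤ} (hf : IsSingularCocycle f)
    {B : Set E} (hB : Convex ℝ B) (hBU : B ⊆ U) {Φ : ℝ → E} {a b : ℝ}
    (hΦ : ContinuousOn Φ (segment ℝ a b)) (hmaps : Set.MapsTo Φ (segment ℝ a b) B) :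
    segmentValue f Φ a b = segmentValue f id (Φ a) (Φ b) := by
  let S : Set (ℝ × ℝ) := Set.Icc 0 1 ×ˢ Set.Icc 0 1
  have hS : Convex ℝ S := (convex_Icc 0 1).prod (convex_Icc 0 1)
  -- Straight-line homotopy inside `B` from the path to its chord. The square is cut along its
  -- diagonal, and its two vertical sides are constant paths of value zero.
  let Ψ : ℝ × ℝ → E := fun z => (1 - z.2) • Φ ((1 - z.1) • a + z.1 • b) +
    z.2 • ((1 - z.1) • Φ a + z.1 • Φ b)
  have hseg : ∀ z ∈ S, (1 - z.1) • a + z.1 • b ∈ segment ℝ a b := fun z hz =>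
    ⟨1 - z.1, z.1, by linarith [hz.1.2], hz.1.1, by ring, rfl⟩
  have hΦa := hmaps (left_mem_segment ℝ a b)
  have hΦb := hmaps (right_mem_segment ℝ a b)
  have hΨU : Set.MapsTo Ψ S U := fun z hz => hBU <|
    hB (hmaps (hseg z hz)) (hB hΦa hΦb (by linarith [hz.1.2]) hz.1.1 (by ring))
      (by linarith [hz.2.2]) hz.2.1 (by ring)
  have hΨ : ContinuousOn Ψ S := by
    have h1 : ContinuousOn (fun z : ℝ × ℝ => Φ ((1 - z.1) • a + z.1 • b)) S :=
      hΦ.comp (by fun_prop) hseg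
    exact ((continuousOn_const.sub continuousOn_snd).smul h1).add (by fun_prop)
  have m00 : ((0, 0) : ℝ × ℝ) ∈ S := by simp [S]
  have m01 : ((0, 1) : ℝ × ℝ) ∈ S := by simp [S]
  have m10 : ((1, 0) : ℝ × ℝ) ∈ S := by simp [S]
  have m11 : ((1, 1) : ℝ × ℝ) ∈ S := by simp [S]
  have t1 := segmentValue_triangle hf hS hΨ hΨU m00 m10 m11
  have t2 := segmentValue_triangle hf hS hΨ hΨU m00 m01 m11
  have e1 : segmentValue f Ψ ((0, 0) : ℝ × ℝ) (1, 0) = segmentValue f Φ a b := by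
    refine segmentValue_congr f fun s t _ _ hst => ?_
    obtain rfl : s = 1 - t := by linarith
    simp [Ψ]
  have e2 : segmentValue f Ψ ((0, 1) : ℝ × ℝ) (1, 1) = segmentValue f id (Φ a) (Φ b) := by
    refine segmentValue_congr f fun s t _ _ hst => ?_
    obtain rfl : s = 1 - t := by linarith
    simp [Ψ]
  have e3 : segmentValue f Ψ ((1, 0) : ℝ × ℝ) (1, 1) = 0 := by
    refine segmentValue_const hf (hBU hΦb) fun s t _ _ hst => ?_
    obtain rfl : s = 1 - t := by linarith
    simp [Ψ, ← add_smul]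
  have e4 : segmentValue f Ψ ((0, 0) : ℝ × ℝ) (0, 1) = 0 := by
    refine segmentValue_const hf (hBU hΦa) fun s t _ _ hst => ?_
    obtain rfl : s = 1 - t := by linarith
    simp [Ψ, ← add_smul]
  omega

/-- A set `U` is generically conical if any finite family of segments of `U` can be coned off
inside `U` from a common apex. -/
def GenericallyConical (U : Set E) : Prop :=
  ∀ s : List (E × E), (∀ e ∈ s, segment ℝ e.1 e.2 ⊆ U) →
    ∃ p, ∀ e ∈ s, convexHull ℝ {p, e.1, e.2} ⊆ U

theorem segmentValue_cone {f : C(stdSimplex ℝ (Fin 2), U) → ℤ} (hf : IsSingularCocycle f)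
    {p a b : E} (h : convexHull ℝ {p, a, b} ⊆ U) :
    segmentValue f id a p + segmentValue f id p b = segmentValue f id a b :=
  segmentValue_triangle hf (Φ := id) (convex_convexHull ℝ _) continuousOn_id h
    (subset_convexHull ℝ _ (by simp)) (subset_convexHull ℝ _ (by simp))
    (subset_convexHull ℝ _ (by simp))

theorem segment_subset_of_cone {p a b : E} (h : convexHull ℝ {p, a, b} ⊆ U) :
    segment ℝ a p ⊆ U ∧ segment ℝ p a ⊆ U ∧ segment ℝ p b ⊆ U := by
  refine ⟨?_, ?_, ?_⟩ <;>
  exact (segment_subset_convexHull (by simp) (by simp)).trans h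

/-- Values along broken lines with one intermediate vertex do not depend on that vertex. -/
theorem segmentValue_broken_eq (hU : GenericallyConical U)
    {f : C(stdSimplex ℝ (Fin 2), U) → ℤ} (hf : IsSingularCocycle f) {x y p p' : E}
    (h1 : segment ℝ x p ⊆ U) (h2 : segment ℝ p y ⊆ U) (h1' : segment ℝ x p' ⊆ U)
    (h2' : segment ℝ p' y ⊆ U) :
    segmentValue f id x p + segmentValue f id p y =
      segmentValue f id x p' + segmentValue f id p' y := by
  -- With a common apex `r`, both broken lines have the value of the one through `r`.
  obtain ⟨r, hr⟩ := hU [(x, p), (p, y), (x, p'), (p', y)] (by simp [h1, h2, h1', h2'])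
  simp only [List.mem_cons, List.not_mem_nil, or_false, forall_eq_or_imp, forall_eq] at hr
  obtain ⟨r1, r2, r3, r4⟩ := hr
  have e1 := segmentValue_cone hf r1
  have e2 := segmentValue_cone hf r2
  have e3 := segmentValue_cone hf r3
  have e4 := segmentValue_cone hf r4
  have e5 := segmentValue_comm hf (segment_subset_of_cone r2).1
  have e6 := segmentValue_comm hf (segment_subset_of_cone r4).1
  omega

/-- A cocycle is a coboundary on straight segments. -/
theorem exists_primitive_on_segments (hU : GenericallyConical U)
    {f : C(stdSimplex ℝ (Fin 2), U) → ℤ} (hf : IsSingularCocycle f) :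
    ∃ g : E → ℤ, ∀ a b, segment ℝ a b ⊆ U → segmentValue f id a b = g b - g a := by
  classical
  rcases U.eq_empty_or_nonempty with rfl | ⟨x, hx⟩
  · exact ⟨0, fun a b h => (h (left_mem_segment ℝ a b)).elim⟩
  have hex : ∀ y ∈ U, ∃ p, segment ℝ x p ⊆ U ∧ segment ℝ p y ⊆ U := by
    intro y hy
    -- Coning off degenerate segments joins two points by a broken line through the apex.
    obtain ⟨p, hp⟩ := hU [(x, x), (y, y)] (by simp [hx, hy])
    simp only [List.mem_cons, List.not_mem_nil, or_false, forall_eq_or_imp, forall_eq] at hp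
    exact ⟨p, (segment_subset_of_cone hp.1).1, (segment_subset_of_cone hp.2).2.1⟩
  choose! P hP1 hP2 using hex
  refine ⟨fun y => segmentValue f id x (P y) + segmentValue f id (P y) y, fun a b hab => ?_⟩
  have ha := hab (left_mem_segment ℝ a b)
  have hb := hab (right_mem_segment ℝ a b)
  -- The broken lines from `x` to `a` and to `b` may both be routed through this `p`; the triangle
  -- `p, a, b` then compares them.
  obtain ⟨p, hp⟩ := hU [(x, x), (a, b)] (by simp [hx, hab])
  simp only [List.mem_cons, List.not_mem_nil, or_false, forall_eq_or_imp, forall_eq] at hp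
  have e1 := segmentValue_cone hf hp.2
  have hs := segment_subset_of_cone hp.2
  have hsx := (segment_subset_of_cone hp.1).1
  have e2 := segmentValue_broken_eq hU hf (hP1 a ha) (hP2 a ha) hsx hs.2.1
  have e3 := segmentValue_broken_eq hU hf (hP1 b hb) (hP2 b hb) hsx hs.2.2
  have e4 := segmentValue_comm hf hs.1
  beta_reduce
  omega

/-- A cocycle on a generically conical open set is a coboundary. -/
theorem exists_primitive (hU : GenericallyConical U) (ho : IsOpen U)
    {f : C(stdSimplex ℝ (Fin 2), U) → ℤ} (hf : IsSingularCocycle f) :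
    ∃ g : E → ℤ, ∀ Φ : ℝ → E, ContinuousOn Φ (Set.Icc 0 1) → Set.MapsTo Φ (Set.Icc 0 1) U →
      segmentValue f Φ 0 1 = g (Φ 1) - g (Φ 0) := by
  obtain ⟨g, hg⟩ := exists_primitive_on_segments hU hf
  refine ⟨g, fun Φ hΦ hmaps => ?_⟩
  -- Short pieces of the path lie in a ball inside `U` and can be replaced by chords, where `g` is a
  -- primitive. Hence `K` is locally constant, so constant on the connected interval.
  let K : Set.Icc (0 : ℝ) 1 → ℤ := fun t => segmentValue f Φ 0 t - g (Φ t)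
  have hK : IsLocallyConstant K := by
    rw [IsLocallyConstant.iff_eventually_eq]
    intro t
    obtain ⟨ε, hε, hball⟩ := Metric.isOpen_iff.1 ho _ (hmaps t.2)
    obtain ⟨δ, hδ, hΦδ⟩ := Metric.continuousOn_iff.1 hΦ t t.2 ε hε
    filter_upwards [Metric.ball_mem_nhds t hδ] with s hs
    have hsub : segment ℝ (t : ℝ) s ⊆ Set.Icc 0 1 := (convex_Icc 0 1).segment_subset t.2 s.2
    have hsub' : segment ℝ (t : ℝ) s ⊆ Metric.ball (t : ℝ) δ :=
      (convex_ball (t : ℝ) δ).segment_subset (Metric.mem_ball_self hδ) hs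
    have hmaps' : Set.MapsTo Φ (segment ℝ (t : ℝ) s) (Metric.ball (Φ t) ε) := fun r hr =>
      hΦδ r (hsub hr) (hsub' hr)
    have e1 := segmentValue_eq_of_convex hf (convex_ball _ _) hball (hΦ.mono hsub) hmaps'
    have e2 := hg (Φ t) (Φ s) (((convex_ball _ _).segment_subset
      (hmaps' (left_mem_segment ℝ _ _)) (hmaps' (right_mem_segment ℝ _ _))).trans hball)
    have e3 := segmentValue_triangle hf (convex_Icc (0 : ℝ) 1) hΦ hmaps
      (Set.left_mem_Icc.2 zero_le_one) t.2 s.2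
    simp only [K]
    omega
  have h01 := hK.apply_eq_of_isPreconnected isPreconnected_univ
    (Set.mem_univ (⟨0, Set.left_mem_Icc.2 zero_le_one⟩ : Set.Icc (0 : ℝ) 1))
    (Set.mem_univ ⟨1, Set.right_mem_Icc.2 zero_le_one⟩)
  have h00 := segmentValue_self hf (Φ := Φ) (hmaps (Set.left_mem_Icc.2 zero_le_one))
  simp only [K] at h01
  omega

end Cochain

/-- Generically conical open sets have trivial first singular cohomology. -/
theorem subsingleton_singularCohomology_one_of_genericallyConical {n : ℕ}
    {U : Set (Fin n → ℝ)} (hU : GenericallyConical U) (ho : IsOpen U) :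
    Subsingleton (singularCohomology (TopCat.of U) 1) := by
  refine subsingleton_singularCohomology_one _ fun (f : C(stdSimplex ℝ (Fin 2), U) → ℤ) hf => ?_
  obtain ⟨g, hg⟩ := exists_primitive hU ho hf
  refine ⟨fun c => g (c (stdSimplex.vertex 0) : U), fun (γ : C(stdSimplex ℝ (Fin 2), U)) => ?_⟩
  let P : Set.Icc (0 : ℝ) 1 → stdSimplex ℝ (Fin 2) := fun t =>
    ⟨![1 - t, t], by
      constructor
      · intro i
        fin_cases i
        · simpa using t.2.2
        · simpa using t.2.1
      · simp [Fin.sum_univ_two]⟩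
  have hP : Continuous P := by
    refine Continuous.subtype_mk (continuous_pi fun i => ?_) _
    fin_cases i
    · exact continuous_const.sub continuous_subtype_val
    · exact continuous_subtype_val
  -- The path `γ` as a function of its second barycentric coordinate, extended to `ℝ` by clamping.
  let Φ : ℝ → Fin n → ℝ := fun t => (γ (P (Set.projIcc 0 1 zero_le_one t)) : U)
  have hΦ : Continuous Φ := by
    have := hP.comp (continuous_projIcc (h := zero_le_one (α := ℝ)))
    exact continuous_subtype_val.comp (γ.continuous.comp this)
  have hΦP : ∀ p : stdSimplex ℝ (Fin 2), Φ (p 1) = (γ p : U) := by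
    intro p
    have h0 := p.2.1 0
    have h1 := p.2.1 1
    have hs : p 0 + p 1 = 1 := (Fin.sum_univ_two _).symm.trans p.2.2
    simp only [Φ]
    rw [Set.projIcc_of_mem zero_le_one (x := p 1) ⟨h1, by change 0 ≤ p 0 at h0; linarith⟩]
    congr 2
    ext i
    fin_cases i
    · change 1 - p 1 = p 0
      linarith
    · rfl
  have hv : ∀ i : Fin 2, ((γ.comp (stdFace 0 i)) (stdSimplex.vertex 0) : U) =
      γ (stdSimplex.vertex (i.succAbove 0)) := by
    intro i
    change γ (stdSimplex.map i.succAbove (stdSimplex.vertex 0)) = _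
    rw [stdSimplex.map_vertex]
  have hmain := hg Φ hΦ.continuousOn fun t _ => (γ _).2
  have e1 : segmentValue f Φ 0 1 = f γ := by
    rw [← evalCochain_of f]
    unfold segmentValue
    congr 1
    funext p
    rw [← hΦP]
    simp
  have e2 : Φ 1 = (γ (stdSimplex.vertex 1) : U) := by
    rw [← hΦP]
    simp
  have e3 : Φ 0 = (γ (stdSimplex.vertex 0) : U) := by
    rw [← hΦP]
    simp
  rw [e1, e2, e3] at hmain
  beta_reduce
  rw [hv, hv]
  exact hmain

/-! ### Generic apices for the `k`-equal arrangement -/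

/-- If at least four coordinates are involved, there is a nonzero functional vanishing on the
diagonal of these coordinates and on two further vectors. -/
theorem exists_dual_vanishing {n : ℕ} (s : Finset (Fin n)) (hs : 4 ≤ s.card) (a b : Fin n → ℝ) :
    ∃ ψ : (Fin n → ℝ) →ₗ[ℝ] ℝ, LinearMap.ker ψ ≠ ⊤ ∧ ψ a = 0 ∧ ψ b = 0 ∧
      ∀ x : Fin n → ℝ, (∀ i ∈ s, ∀ j ∈ s, x i = x j) → ψ x = 0 := by
  -- Three linear conditions on the at least four coefficients `d`: total sum zero, and vanishing on
  -- `a` and on `b`.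
  let L : (s → ℝ) →ₗ[ℝ] (Fin 3 → ℝ) :=
    LinearMap.pi ![∑ i, LinearMap.proj i, ∑ i : s, a i • LinearMap.proj i,
      ∑ i : s, b i • LinearMap.proj i]
  have hL : LinearMap.ker L ≠ ⊥ := LinearMap.ker_ne_bot_of_finrank_lt (by simp; omega)
  obtain ⟨d, hd, hd0⟩ := Submodule.exists_mem_ne_zero_of_ne_bot hL
  rw [LinearMap.mem_ker] at hd
  have h0 : ∑ i, d i = 0 := by simpa [L] using congrFun hd 0
  have h1 : ∑ i : s, a i * d i = 0 := by simpa [L] using congrFun hd 1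
  have h2 : ∑ i : s, b i * d i = 0 := by simpa [L] using congrFun hd 2
  let ψ : (Fin n → ℝ) →ₗ[ℝ] ℝ := ∑ i : s, d i • LinearMap.proj (i : Fin n)
  have hψ : ∀ x, ψ x = ∑ i : s, x i * d i := fun x => by simp [ψ, mul_comm]
  refine ⟨ψ, ?_, by rw [hψ, h1], by rw [hψ, h2], ?_⟩
  · intro htop
    refine hd0 (funext fun i => ?_)
    have : ψ (Pi.single (i : Fin n) 1) = 0 := by
      rw [← LinearMap.mem_ker, htop]
      exact Submodule.mem_top
    simpa [hψ, Pi.single_apply, Subtype.coe_inj] using this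
  · intro x hx
    rw [hψ]
    obtain ⟨j, hj⟩ := Finset.card_pos.1 (by omega : 0 < s.card)
    rw [Finset.sum_congr rfl fun i _ => by rw [hx i i.2 j hj], ← Finset.mul_sum, h0, mul_zero]

/-- Finitely many proper subspaces do not cover `ℝⁿ`, so some `p` avoids the kernels of all the
functionals. A point `u • p + v • y` of the triangle with `u ≠ 0` then lies off the arrangement; if
`u = 0`, it is on the original segment. -/
theorem genericallyConical_kEqualComplement (n k : ℕ) (hk : 4 ≤ k) :
    GenericallyConical (kEqualArrangement n k)ᶜ := by
  intro l hl
  have hfin : Finite {e // e ∈ l} := l.finite_toSet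
  choose ψ htop hψ1 hψ2 hψ using
    fun z : {s : Finset (Fin n) // s.card = k} × {e // e ∈ l} =>
      exists_dual_vanishing z.1.1 (by rw [z.1.2]; exact hk) z.2.1.1 z.2.1.2
  have hp : ∃ p, ∀ z, ψ z p ≠ 0 := by
    by_contra! hc
    obtain ⟨z, hz⟩ := Subspace.exists_eq_top_of_iUnion_eq_univ
      (p := fun z => LinearMap.ker (ψ z)) (Set.eq_univ_of_forall fun p => by
        obtain ⟨z, hz⟩ := hc p
        exact Set.mem_iUnion.2 ⟨z, hz⟩)
    exact htop z hz
  obtain ⟨p, hp⟩ := hp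
  refine ⟨p, fun e he x hx hxk => ?_⟩
  rw [convexHull_insert (by simp), convexHull_pair, convexJoin_singleton_left,
    Set.mem_iUnion₂] at hx
  obtain ⟨y, hy, u, v, -, -, huv, rfl⟩ := hx
  by_cases hu : u = 0
  · obtain rfl : v = 1 := by simpa [hu] using huv
    refine hl e he hy ?_
    simpa [hu] using hxk
  · obtain ⟨s, hs, hxs⟩ := hxk
    let z : {s : Finset (Fin n) // s.card = k} × {e // e ∈ l} := (⟨s, hs⟩, ⟨e, he⟩)
    have h1 : ψ z (u • p + v • y) = 0 := hψ z _ hxs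
    have h2 : ψ z y = 0 := by
      obtain ⟨c, d, -, -, -, rfl⟩ := hy
      rw [map_add, map_smul, map_smul, hψ1 z, hψ2 z, smul_zero, smul_zero, add_zero]
    rw [map_add, map_smul, map_smul, h2, smul_zero, add_zero, smul_eq_mul] at h1
    exact (mul_eq_zero.1 h1).elim hu (hp z)

theorem isOpen_kEqualComplement (n k : ℕ) : IsOpen (kEqualArrangement n k)ᶜ := by
  rw [isOpen_compl_iff]
  have : kEqualArrangement n k = ⋃ s : {s : Finset (Fin n) // s.card = k},
      {x | ∀ i ∈ s.1, ∀ j ∈ s.1, x i = x j} := by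
    ext x
    simp [kEqualArrangement]
  rw [this]
  refine isClosed_iUnion_of_finite fun s => ?_
  simp only [Set.ofPred_forall]
  exact isClosed_iInter fun i => isClosed_iInter fun _ => isClosed_iInter fun j =>
    isClosed_iInter fun _ => isClosed_eq (continuous_apply i) (continuous_apply j)

end DiscreteHomotopy

theorem theorem5p8 (n k : ℕ) (hk : 4 ≤ k) :
    (k ≤ n → ∀ σ₀ : DiscreteHomotopy.BaseSimplex (DiscreteHomotopy.booleanOrderComplex n) (n - k),
      Nonempty (DiscreteHomotopy.A₁ (DiscreteHomotopy.booleanOrderComplex n) (n - k) σ₀ ≃* Unit)) ∧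
    DiscreteHomotopy.firstBettiNumber (DiscreteHomotopy.kEqualComplement n k) = 0 := by
  constructor
  · intro hkn σ₀
    have h1 : ∀ x : DiscreteHomotopy.A₁ (DiscreteHomotopy.booleanOrderComplex n) (n - k) σ₀,
        x = 1 := by
      rintro ⟨γ⟩
      -- The inequality `n - k + 4 ≤ n` needs `k ≤ n`, since the subtraction is truncated, as well
      -- as `4 ≤ k`.
      exact Quotient.sound (DiscreteHomotopy.aHomotopy_const (by omega) γ)
    have : Unique (DiscreteHomotopy.A₁ (DiscreteHomotopy.booleanOrderComplex n) (n - k) σ₀) :=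
      ⟨⟨1⟩, h1⟩
    exact ⟨MulEquiv.ofUnique⟩
  · have := DiscreteHomotopy.subsingleton_singularCohomology_one_of_genericallyConical
      (DiscreteHomotopy.genericallyConical_kEqualComplement n k hk)
      (DiscreteHomotopy.isOpen_kEqualComplement n k)
    exact rank_subsingleton' ℤ _
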